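/- Let $\mathbf{FHilb}$ be the category of finite-dimensional complex Hilbert spaces and linear maps, with the usual tensor product $\otimes$, unit object $\mathbb{C}$, and with the adjoint $f\mapsto f^\dagger$ as dagger. A *dagger Frobenius algebra* in $\mathbf{FHilb}$ is an object $A$ with linear maps $\mu_A\colon A\otimes A\to A$ and $\eta_A\colon\mathbb{C}\to A$ that are associative and unital and satisfy the Frobenius law $(\mu_A\otimes 1)(1\otimes\delta_A)=\delta_A\mu_A=(1\otimes\mu_A)(\delta_A\otimes 1)$, where $\delta_A=\mu_A^\dagger$. Its counit is $\epsilon_A=\eta_A^\dagger$, and it has a cap $\epsilon_A\mu_A\colon A\otimes A\to\mathbb{C}$ and a cup $\delta_A\eta_A\colon\mathbb{C}\to A\otimes A$. It is *commutative* if $\mu_A\sigma_{A,A}=\mu_A$, where $\sigma_{A,A}(a\otimes b)=b\otimes a$. It is *normalisable* if there is a map $z\colon A\to A$ that is central, i.e. $z\mu_A=\mu_A(z\otimes 1)=\mu_A(1\otimes z)$, and positive definite, i.e. an isomorphism of the form $h^\dagger h$, such that $\mathrm{Tr}_A(\mu_A)\circ z^2=\epsilon_A$, where $\mathrm{Tr}_A(\mu_A)(a)$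 is the trace of $b\mapsto\mu_A(a\otimes b)$. A *copyable point* of $A$ is a nonzero vector $p\in A$ with $\delta_A(p)=p\otimes p$. The objects of $\mathbf{Stoch}[\mathbf{FHilb}]$ are the commutative normalisable dagger Frobenius algebras in $\mathbf{FHilb}$. Its morphisms $A\to B$ are the linear maps $f\colon A\to B$ for which there are a commutative normalisable dagger Frobenius algebra $X$ and a linear map $g\colon A\to X\otimes B$ such that $$\delta_B\circ f\circ\mu_A = J\circ(g_*\otimes g)\colon A\otimes A\to B\otimes B .$$ Here $J\colon(X\otimes B)\otimes(X\otimes B)\to B\otimes B$ joins the two factors $X$ by the cap of $X$, and $g_*\colon A\to X\otimes B$ is the transpose of $g^\dagger$ with respect to the caps and cups of $A$, $X$ and $B$. A morphism $f\colon A\to B$ is *normalised* if $\epsilon_B\circ f=\epsilon_A$. Let $\mathbf{FinStoch}$ be the category whose objects are finite sets $I$ (thought of as the Hilbert spaces $\mathbb{C}^I$), whose morphisms $I\to J$ are the stochastic maps, i.e. the $J\times I$ matrices with nonnegative real entries whose every column sums to one, and whose composition is matrix multiplication. **Corollary.** $\mathbf{Stoch}[\mathbf{FHilb}]$ contains identities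 and is closed under composition, so that it and its subcategory of normalised morphisms are categories. There is an equivalence of categories $E$ from the category of normalised morphisms in $\mathbf{Stoch}[\mathbf{FHilb}]$ to $\mathbf{FinStoch}$, given by taking matrices with respect to copyable points. That is, for each object $A$ there is a basis $(b^A_i)_{i\in E(A)}$ of $A$ whose members are pairwise orthogonal and are exactly the copyable points of $A$, such that every normalised morphism $f\colon A\to B$ satisfies $$f(b^A_i)=\sum_{j\in E(B)}E(f)_{ji}\,b^B_j\qquad\text{for all } i\in E(A).$$ -/

import Mathlib

open CategoryTheory
open scoped TensorProduct

universe u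

noncomputable section

/-- Objects of `FHilb`: finite-dimensional complex Hilbert spaces. (Finite dimension gives
completeness.) The morphisms of `FHilb` are the linear maps, its dagger is
`LinearMap.adjoint`, and its monoidal product is the Hilbert space tensor product `⊗[ℂ]` with
unit `ℂ`. -/
structure FHilb : Type (u + 1) where
  carrier : Type u
  [normedAddCommGroup : NormedAddCommGroup carrier]
  [innerProductSpace : InnerProductSpace ℂ carrier]
  [finiteDimensional : FiniteDimensional ℂ carrier]

namespace FHilb

instance : CoeSort FHilb.{u} (Type u) := ⟨FHilb.carrier⟩

attribute [instance] normedAddCommGroup innerProductSpace finiteDimensional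

/-- An endomorphism is positive when it is of the form `h† ∘ h`, and positive definite when it
is moreover an isomorphism. -/
def PositiveDefinite {A : FHilb.{u}} (z : A →ₗ[ℂ] A) : Prop :=
  Function.Bijective z ∧
    ∃ (K : FHilb.{u}) (h : A →ₗ[ℂ] K), z = LinearMap.adjoint h ∘ₗ h

end FHilb

/-- Dagger Frobenius algebra structures on an object `A` of `FHilb`: an associative unital
multiplication that satisfies the Frobenius law together with its adjoint. -/
structure DaggerFrobenius (A : FHilb.{u}) where
  mul : A ⊗[ℂ] A →ₗ[ℂ] A
  unit : ℂ →ₗ[ℂ] A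
  mul_assoc : mul ∘ₗ mul.rTensor A =
    mul ∘ₗ mul.lTensor A ∘ₗ (TensorProduct.assoc ℂ A A A).toLinearMap
  unit_mul : mul ∘ₗ unit.rTensor A = (TensorProduct.lid ℂ A).toLinearMap
  mul_unit : mul ∘ₗ unit.lTensor A = (TensorProduct.rid ℂ A).toLinearMap
  frobenius_left :
    mul.rTensor A ∘ₗ (TensorProduct.assoc ℂ A A A).symm.toLinearMap ∘ₗ
      (LinearMap.adjoint mul).lTensor A = LinearMap.adjoint mul ∘ₗ mul
  frobenius_right :
    mul.lTensor A ∘ₗ (TensorProduct.assoc ℂ A A A).toLinearMap ∘ₗ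
      (LinearMap.adjoint mul).rTensor A = LinearMap.adjoint mul ∘ₗ mul

namespace DaggerFrobenius

variable {A X B : FHilb.{u}}

/-- The comultiplication, the adjoint of the multiplication. -/
def comul (F : DaggerFrobenius A) : A →ₗ[ℂ] A ⊗[ℂ] A := LinearMap.adjoint F.mul

/-- The counit, the adjoint of the unit. -/
def counit (F : DaggerFrobenius A) : A →ₗ[ℂ] ℂ := LinearMap.adjoint F.unit

/-- The cap of the self-duality that the algebra induces on `A`. -/
def cap (F : DaggerFrobenius A) : A ⊗[ℂ] A →ₗ[ℂ] ℂ := F.counit ∘ₗ F.mul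

/-- The cup of the self-duality that the algebra induces on `A`. -/
def cup (F : DaggerFrobenius A) : ℂ →ₗ[ℂ] A ⊗[ℂ] A := F.comul ∘ₗ F.unit

def IsCommutative (F : DaggerFrobenius A) : Prop :=
  F.mul ∘ₗ (TensorProduct.comm ℂ A A).toLinearMap = F.mul

def IsCentral (F : DaggerFrobenius A) (z : A →ₗ[ℂ] A) : Prop :=
  z ∘ₗ F.mul = F.mul ∘ₗ z.rTensor A ∧ z ∘ₗ F.mul = F.mul ∘ₗ z.lTensor A

/-- The loop `Tr_A(mul) : A → ℂ`, which sends `a` to the trace of `b ↦ a b`. -/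
def loop (F : DaggerFrobenius A) : A →ₗ[ℂ] ℂ :=
  LinearMap.trace ℂ A ∘ₗ TensorProduct.curry F.mul

/-- There is a normaliser: a central positive definite `z` with `Tr_A(mul) ∘ z² = counit`. -/
def IsNormalisable (F : DaggerFrobenius A) : Prop :=
  ∃ z : A →ₗ[ℂ] A, F.IsCentral z ∧ FHilb.PositiveDefinite z ∧ F.loop ∘ₗ z ∘ₗ z = F.counit

/-- The cup on `X ⊗ B` built from the cups of `X` and `B`. -/
def tensorCup (FX : DaggerFrobenius X) (FB : DaggerFrobenius B) :
    ℂ →ₗ[ℂ] (X ⊗[ℂ] B) ⊗[ℂ] (X ⊗[ℂ] B) :=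
  (TensorProduct.tensorTensorTensorComm ℂ X X B B).toLinearMap ∘ₗ
    TensorProduct.map FX.cup FB.cup ∘ₗ (TensorProduct.lid ℂ ℂ).symm.toLinearMap

/-- The conjugate `g_*` of `g : A → X ⊗ B`: the transpose of `g†`, where wires are bent with
the caps and cups of the three Frobenius algebras. -/
def conj (FA : DaggerFrobenius A) (FX : DaggerFrobenius X) (FB : DaggerFrobenius B)
    (g : A →ₗ[ℂ] X ⊗[ℂ] B) : A →ₗ[ℂ] X ⊗[ℂ] B :=
  (TensorProduct.rid ℂ (X ⊗[ℂ] B)).toLinearMap ∘ₗ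
    (FA.cap ∘ₗ (LinearMap.adjoint g).rTensor A).lTensor (X ⊗[ℂ] B) ∘ₗ
    (TensorProduct.assoc ℂ (X ⊗[ℂ] B) (X ⊗[ℂ] B) A).toLinearMap ∘ₗ
    (tensorCup FX FB).rTensor A ∘ₗ
    (TensorProduct.lid ℂ A).symm.toLinearMap

/-- Connects the two `X`-wires of `(X ⊗ B) ⊗ (X ⊗ B)` by the cap of `X`. -/
def join (FX : DaggerFrobenius X) (B : FHilb.{u}) :
    (X ⊗[ℂ] B) ⊗[ℂ] (X ⊗[ℂ] B) →ₗ[ℂ] B ⊗[ℂ] B :=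
  (TensorProduct.lid ℂ (B ⊗[ℂ] B)).toLinearMap ∘ₗ FX.cap.rTensor (B ⊗[ℂ] B) ∘ₗ
    (TensorProduct.tensorTensorTensorComm ℂ X B X B).toLinearMap

/-- The nonzero copyable points: `p ≠ 0` with `comul p = p ⊗ p`. -/
def copyablePoints (F : DaggerFrobenius A) : Set A :=
  {p | p ≠ 0 ∧ F.comul p = p ⊗ₜ[ℂ] p}

end DaggerFrobenius

/-- Commutative normalisable dagger Frobenius algebras in `FHilb`: the objects of
`Stoch[FHilb]`. -/
structure StochObj : Type (u + 1) where
  space : FHilb.{u}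
  alg : DaggerFrobenius space
  isCommutative : alg.IsCommutative
  isNormalisable : alg.IsNormalisable

namespace StochObj

/-- All morphisms of `FHilb` between the underlying Hilbert spaces. -/
@[ext]
structure Hom (A B : StochObj.{u}) where
  lin : A.space →ₗ[ℂ] B.space

/-- The ambient category, with arbitrary linear maps as morphisms; `Stoch[FHilb]` is the wide
subcategory of it cut out by `stoch` below. -/
instance : Category StochObj.{u} where
  Hom := Hom
  id _ := ⟨LinearMap.id⟩
  comp f g := ⟨g.lin ∘ₗ f.lin⟩

/-- The morphisms of `Stoch[FHilb]`: those `f : A → B` such that, for some commutative normalisable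
dagger Frobenius algebra `X` and some morphism `g : A → X ⊗ B`, the map
`comul_B ∘ f ∘ mul_A : A ⊗ A → B ⊗ B` is `g_* ⊗ g` followed by the cap that joins the two
`X`-wires. -/
def stoch : MorphismProperty StochObj.{u} := fun A B f =>
  ∃ (X : StochObj.{u}) (g : A.space →ₗ[ℂ] X.space ⊗[ℂ] B.space),
    B.alg.comul ∘ₗ f.lin ∘ₗ A.alg.mul =
      X.alg.join B.space ∘ₗ TensorProduct.map (DaggerFrobenius.conj A.alg X.alg B.alg g) g

/-- The normalised morphisms: those that preserve counits. -/
def normalised : MorphismProperty StochObj.{u} := fun A B f =>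
  B.alg.counit ∘ₗ f.lin = A.alg.counit

instance : normalised.{u}.IsMultiplicative where
  id_mem _ := rfl
  comp_mem f g hf hg := by
    change _ ∘ₗ g.lin ∘ₗ f.lin = _
    rw [← LinearMap.comp_assoc]
    exact (congrArg (fun k => k ∘ₗ f.lin) hg).trans hf

end StochObj

/-- Objects of the category of stochastic maps: finite sets `ι`, which index the standard basis
of the Hilbert space `ℂ^ι`. -/
structure FinStoch : Type (u + 1) where
  ι : Type u
  [fintype : Fintype ι]

namespace FinStoch

attribute [instance] fintype

/-- Stochastic maps `ℂ^I → ℂ^J`: matrices with nonnegative real entries in which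
every column sums to one; the rows are indexed by `J` and the columns by `I`. -/
@[ext]
structure Hom (I J : FinStoch.{u}) where
  matrix : Matrix J.ι I.ι ℝ
  nonneg : ∀ j i, 0 ≤ matrix j i
  sum_col : ∀ i, ∑ j, matrix j i = 1

open Classical in
/-- Composition is matrix multiplication. -/
instance : Category FinStoch.{u} where
  Hom := Hom
  id I :=
    { matrix := 1
      nonneg := fun j i => by
        by_cases h : j = i <;> simp [Matrix.one_apply, h]
      sum_col := fun i => by simp [Matrix.one_apply] }
  comp M N :=
    { matrix := N.matrix * M.matrix
      nonneg := fun k i =>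
        Finset.sum_nonneg fun j _ => mul_nonneg (N.nonneg k j) (M.nonneg j i)
      sum_col := fun i => by
        simp only [Matrix.mul_apply]
        rw [Finset.sum_comm]
        simp [← Finset.sum_mul, N.sum_col, M.sum_col] }
  id_comp M := Hom.ext (Matrix.mul_one M.matrix)
  comp_id M := Hom.ext (Matrix.one_mul M.matrix)
  assoc M N P := Hom.ext (Matrix.mul_assoc P.matrix N.matrix M.matrix).symm

end FinStoch

end

/-! Write `L_a` for left multiplication by `a`. The Frobenius law makes the adjoint of `L_a` again a
left multiplication, by `a* = L_a†(1)`. In a commutative algebra the operators `L_a` therefore form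
a commuting family closed under adjoints, and the spectral theorem diagonalises them jointly. A
copyable point is a joint eigenvector of the `L_a†`, scaled so that its inner product with `1` is
one; conversely each joint eigenvector of the `L_a` is a multiple of such a point. Distinct copyable
points are orthogonal, so they form a basis (`span_copyablePoints`, `inner_eq_zero`).

In such bases `b_i b_k = δ_ik ‖b_i‖² b_i`, the counit is 1 on every `b_i`, and `g_*` has the
entrywise conjugate matrix of `g`. The condition defining `stoch` becomes `δ_ii' δ_jj' ‖b_i‖² f_ji =
∑ x, conj(g_(x,j),i) g_(x,j'),i' ‖x‖²`. Its diagonal forces `f_ji ≥ 0`, and a suitable `g` can be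
built from square roots whenever all `f_ji ≥ 0` (`stoch_iff`). Preserving counits means that columns
sum to one. Taking matrices is thus a fully faithful functor to stochastic matrices, and the
algebras `ℂ^κ` make it essentially surjective. -/

noncomputable section

/-! ### Copyable points as an orthogonal basis of joint eigenvectors. -/

namespace DaggerFrobenius

variable {A X B : FHilb.{u}}

/-- Left multiplication by an element. -/
def leftMul (F : DaggerFrobenius A) : A →ₗ[ℂ] A →ₗ[ℂ] A := TensorProduct.curry F.mul

theorem leftMul_apply (F : DaggerFrobenius A) (a b : A) : F.leftMul a b = F.mul (a ⊗ₜ b) := rfl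

theorem leftMul_leftMul (F : DaggerFrobenius A) (a b : A) :
    F.leftMul (F.leftMul a b) = F.leftMul a ∘ₗ F.leftMul b := by
  ext c
  simpa [leftMul_apply] using LinearMap.congr_fun F.mul_assoc ((a ⊗ₜ b) ⊗ₜ c)

theorem leftMul_unit (F : DaggerFrobenius A) : F.leftMul (F.unit 1) = LinearMap.id := by
  ext c
  simpa [leftMul_apply] using LinearMap.congr_fun F.unit_mul (1 ⊗ₜ c)

theorem leftMul_apply_unit (F : DaggerFrobenius A) (a : A) : F.leftMul a (F.unit 1) = a := by
  simpa [leftMul_apply] using LinearMap.congr_fun F.mul_unit (a ⊗ₜ 1)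

theorem IsCommutative.leftMul_comm {F : DaggerFrobenius A} (hF : F.IsCommutative) (a b : A) :
    F.leftMul a b = F.leftMul b a := by
  simpa [leftMul_apply] using LinearMap.congr_fun hF (b ⊗ₜ a)

theorem IsCommutative.commute {F : DaggerFrobenius A} (hF : F.IsCommutative) (a b : A) :
    Commute (F.leftMul a) (F.leftMul b) := by
  change F.leftMul a ∘ₗ F.leftMul b = F.leftMul b ∘ₗ F.leftMul a
  rw [← leftMul_leftMul, ← leftMul_leftMul, hF.leftMul_comm]

theorem inner_tmul_comul (F : DaggerFrobenius A) (a b c : A) :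
    inner ℂ (a ⊗ₜ[ℂ] b) (F.comul c) = inner ℂ (F.leftMul a b) c := by
  rw [comul, LinearMap.adjoint_inner_right, leftMul_apply]

theorem counit_apply (F : DaggerFrobenius A) (a : A) : F.counit a = inner ℂ (F.unit 1) a := by
  have h := LinearMap.adjoint_inner_right F.unit 1 a
  simpa [counit] using h

/-- Pairing the left tensor factor with a vector. -/
def contract (a : A) : A ⊗[ℂ] A →ₗ[ℂ] A :=
  (TensorProduct.lid ℂ A).toLinearMap ∘ₗ (innerSL ℂ a).toLinearMap.rTensor A

theorem contract_tmul (a b c : A) : contract a (b ⊗ₜ c) = (inner ℂ a b : ℂ) • c := by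
  simp [contract]

theorem inner_contract (a b : A) (t : A ⊗[ℂ] A) :
    inner ℂ b (contract a t) = inner ℂ (a ⊗ₜ[ℂ] b) t := by
  induction t with
  | zero => simp
  | tmul x y => rw [contract_tmul, inner_smul_right, TensorProduct.inner_tmul]
  | add x y hx hy => rw [map_add, inner_add_right, inner_add_right, hx, hy]

/-- Translates statements about the comultiplication into statements about the operators `L_a†`. -/
theorem contract_comul (F : DaggerFrobenius A) (a b : A) :
    contract a (F.comul b) = LinearMap.adjoint (F.leftMul a) b := by
  refine ext_inner_left ℂ fun v => ?_
  rw [inner_contract, inner_tmul_comul, LinearMap.adjoint_inner_right]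

/-- The Frobenius law evaluated at `1 ⊗ b`. -/
theorem comul_eq_mul_comul_unit (F : DaggerFrobenius A) (b : A) :
    F.mul.lTensor A (TensorProduct.assoc ℂ A A A (F.comul (F.unit 1) ⊗ₜ b)) = F.comul b := by
  have h := LinearMap.congr_fun F.frobenius_right (F.unit 1 ⊗ₜ b)
  have h' := LinearMap.congr_fun F.leftMul_unit b
  rw [leftMul_apply] at h'
  simpa [h', comul] using h

theorem contract_lTensor_mul (F : DaggerFrobenius A) (a b : A) (t : A ⊗[ℂ] A) :
    contract a (F.mul.lTensor A (TensorProduct.assoc ℂ A A A (t ⊗ₜ b))) =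
      F.leftMul (contract a t) b := by
  induction t with
  | zero => simp
  | tmul x y => simp [contract_tmul, leftMul_apply]
  | add x y hx hy => simp only [TensorProduct.add_tmul, map_add, hx, hy, LinearMap.add_apply]

/-- The adjoint of a left multiplication is a left multiplication. -/
theorem adjoint_leftMul (F : DaggerFrobenius A) (a : A) :
    LinearMap.adjoint (F.leftMul a) =
      F.leftMul (LinearMap.adjoint (F.leftMul a) (F.unit 1)) := by
  ext b
  rw [← contract_comul, ← contract_comul, ← F.comul_eq_mul_comul_unit b, contract_lTensor_mul]

/-- Contracting `comul p = p ⊗ p` against every `a` on the left loses nothing and turns copyability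
into an eigenvector condition. -/
theorem mem_copyablePoints_iff (F : DaggerFrobenius A) (p : A) :
    p ∈ F.copyablePoints ↔
      p ≠ 0 ∧ ∀ a, LinearMap.adjoint (F.leftMul a) p = (inner ℂ a p : ℂ) • p := by
  refine and_congr_right fun _ => ⟨fun h a => ?_, fun h => ?_⟩
  · rw [← contract_comul, h, contract_tmul]
  · refine TensorProduct.ext_iff_inner_left.2 fun a b => ?_
    rw [inner_tmul_comul, ← LinearMap.adjoint_inner_right, h, inner_smul_right,
      TensorProduct.inner_tmul]

theorem inner_unit_of_mem_copyablePoints {F : DaggerFrobenius A} {p : A}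
    (hp : p ∈ F.copyablePoints) : inner ℂ (F.unit 1) p = (1 : ℂ) := by
  have h := ((F.mem_copyablePoints_iff p).1 hp).2 (F.unit 1)
  have h1 : LinearMap.adjoint (F.leftMul (F.unit 1)) p = p := by
    refine ext_inner_left ℂ fun v => ?_
    rw [LinearMap.adjoint_inner_right, leftMul_unit, LinearMap.id_apply]
  rw [h1] at h
  exact (smul_left_injective ℂ hp.1 (by simpa using h)).symm

theorem leftMul_of_mem_copyablePoints {F : DaggerFrobenius A} {p : A}
    (hp : p ∈ F.copyablePoints) (a : A) : ∃ c : ℂ, F.leftMul a p = c • p := by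
  have h := F.adjoint_leftMul a
  refine ⟨inner ℂ (LinearMap.adjoint (F.leftMul a) (F.unit 1)) p, ?_⟩
  rw [← ((F.mem_copyablePoints_iff p).1 hp).2, ← h, LinearMap.adjoint_adjoint]

/-- The product `p q` is a multiple of both `p` and `q`. Pairing with `1` shows that the two
coefficients agree, so they vanish as `p ≠ q`. Then `0 = ⟨p q, q⟩ = ⟨p ⊗ q, q ⊗ q⟩ = ⟨p, q⟩ ⟨q, q⟩`.
-/
theorem IsCommutative.inner_eq_zero {F : DaggerFrobenius A} (hF : F.IsCommutative) {p q : A}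
    (hp : p ∈ F.copyablePoints) (hq : q ∈ F.copyablePoints) (hpq : p ≠ q) :
    inner ℂ p q = (0 : ℂ) := by
  obtain ⟨c, hc⟩ := leftMul_of_mem_copyablePoints hq p
  obtain ⟨d, hd⟩ := leftMul_of_mem_copyablePoints hp q
  rw [hF.leftMul_comm] at hd
  have hcd : c • q = d • p := hc.symm.trans hd
  have h := congrArg (inner ℂ (F.unit 1)) hcd
  rw [inner_smul_right, inner_smul_right, inner_unit_of_mem_copyablePoints hp,
    inner_unit_of_mem_copyablePoints hq, mul_one, mul_one] at h
  subst h
  have hc0 : c = 0 := by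
    by_contra h0
    exact hpq (smul_right_injective A h0 hcd).symm
  rw [hc0, zero_smul] at hc
  have h := F.inner_tmul_comul p q q
  rw [hc, inner_zero_left, hq.2, TensorProduct.inner_tmul] at h
  exact (mul_eq_zero.1 h).resolve_right (inner_self_ne_zero.2 hq.1)

/-- A joint eigenvector of all left multiplications is a multiple of a copyable point. -/
theorem mem_span_copyablePoints_of_joint_eigenvector (F : DaggerFrobenius A) (v : A)
    (χ : A → ℂ) (h : ∀ a, F.leftMul a v = χ a • v) :
    v ∈ Submodule.span ℂ F.copyablePoints := by
  by_cases hv : v = 0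
  · rw [hv]
    exact zero_mem _
  set s : ℂ := inner ℂ (F.unit 1) v with hs
  set χ' : A → ℂ := fun a => χ (LinearMap.adjoint (F.leftMul a) (F.unit 1)) with hχ'
  have hadj : ∀ a, LinearMap.adjoint (F.leftMul a) v = χ' a • v := fun a => by
    rw [adjoint_leftMul, h]
  -- Since `a = L_a(1)`, the number `s` controls all inner products with `v`; it is nonzero, and
  -- dividing by it gives the copyable scaling.
  have hinner : ∀ a, inner ℂ a v = χ' a * s := fun a => by
    have h1 := LinearMap.adjoint_inner_right (F.leftMul a) (F.unit 1) v
    rw [leftMul_apply_unit, hadj, inner_smul_right] at h1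
    exact h1.symm
  have hs0 : s ≠ 0 := fun h0 => hv (inner_self_eq_zero.1 ((hinner v).trans (by rw [h0, mul_zero])))
  have hp : s⁻¹ • v ∈ F.copyablePoints := by
    refine (F.mem_copyablePoints_iff _).2 ⟨smul_ne_zero (inv_ne_zero hs0) hv, fun a => ?_⟩
    rw [map_smul, hadj, inner_smul_right, hinner, smul_comm]
    congr 1
    field_simp
  have := Submodule.smul_mem _ s (Submodule.subset_span hp)
  rwa [smul_inv_smul₀ hs0] at this

/-- The spectral theorem is applied to the self-adjoint operators `L_a + L_a†`, which commute
because each is itself a left multiplication. -/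
theorem IsCommutative.span_copyablePoints {F : DaggerFrobenius A} (hF : F.IsCommutative) :
    Submodule.span ℂ F.copyablePoints = ⊤ := by
  set T : A → A →ₗ[ℂ] A := fun a => F.leftMul a + LinearMap.adjoint (F.leftMul a) with hT
  have hsymm : ∀ a, (T a).IsSymmetric := fun a => by
    rw [LinearMap.isSymmetric_iff_isSelfAdjoint, IsSelfAdjoint, LinearMap.star_eq_adjoint]
    simp only [hT, map_add, LinearMap.adjoint_adjoint, add_comm]
  have hT' : ∀ a, ∃ c, T a = F.leftMul c := fun a =>
    ⟨a + LinearMap.adjoint (F.leftMul a) (F.unit 1), by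
      simp only [hT]
      rw [map_add, ← adjoint_leftMul]⟩
  have hcomm : Pairwise (Function.onFun Commute T) := fun a b _ => by
    obtain ⟨c, hc⟩ := hT' a
    obtain ⟨d, hd⟩ := hT' b
    rw [Function.onFun, hc, hd]
    exact hF.commute c d
  rw [eq_top_iff, ← LinearMap.IsSymmetric.iSup_iInf_eq_top_of_commute hsymm hcomm, iSup_le_iff]
  intro χ v hv
  rw [Submodule.mem_iInf] at hv
  -- Adjoints are conjugate-linear, so `L_a = (T a - i T (i a)) / 2`; this gives the eigenvalue of
  -- `L_a` on `v`.
  refine F.mem_span_copyablePoints_of_joint_eigenvector v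
    (fun a => (1 / 2 : ℂ) * (χ a - Complex.I * χ (Complex.I • a))) fun a => ?_
  have h1 := Module.End.mem_eigenspace_iff.1 (hv a)
  have h2 := Module.End.mem_eigenspace_iff.1 (hv (Complex.I • a))
  simp only [hT, LinearMap.add_apply, map_smul, map_smulₛₗ, LinearMap.smul_apply,
    Complex.conj_I] at h1 h2
  rw [mul_smul, sub_smul, mul_smul, ← h1, ← h2, smul_add, smul_smul, smul_smul, mul_neg,
    Complex.I_mul_I]
  module

theorem IsCommutative.linearIndependent_copyablePoints {F : DaggerFrobenius A}
    (hF : F.IsCommutative) : LinearIndependent ℂ (Subtype.val : F.copyablePoints → A) :=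
  linearIndependent_of_ne_zero_of_inner_eq_zero (fun p => p.2.1)
    fun p q hpq => hF.inner_eq_zero p.2 q.2 (Subtype.coe_injective.ne hpq)

/-- The copyable points of a commutative dagger Frobenius algebra form a basis. -/
def IsCommutative.copyableBasis {F : DaggerFrobenius A} (hF : F.IsCommutative) :
    Module.Basis F.copyablePoints ℂ A :=
  Module.Basis.mk hF.linearIndependent_copyablePoints (by
    rw [Subtype.range_coe, hF.span_copyablePoints])

theorem IsCommutative.copyableBasis_apply {F : DaggerFrobenius A} (hF : F.IsCommutative)
    (p : F.copyablePoints) : hF.copyableBasis p = p := by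
  rw [copyableBasis, Module.Basis.mk_apply]

end DaggerFrobenius

/-! ### Structure maps in coordinates with respect to copyable points. -/

namespace DaggerFrobenius

variable {A X B : FHilb.{u}}

/-- An orthogonal basis that consists of copyable points. -/
structure IsCopyableBasis {ι : Type*} (F : DaggerFrobenius A) (b : Module.Basis ι ℂ A) : Prop where
  mem (i : ι) : b i ∈ F.copyablePoints
  inner_eq_zero {i j : ι} (h : i ≠ j) : inner ℂ (b i) (b j) = (0 : ℂ)

theorem IsCommutative.isCopyableBasis {F : DaggerFrobenius A} (hF : F.IsCommutative) :
    F.IsCopyableBasis hF.copyableBasis where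
  mem p := by
    rw [hF.copyableBasis_apply]
    exact p.2
  inner_eq_zero {p q} h := by
    rw [hF.copyableBasis_apply, hF.copyableBasis_apply]
    exact hF.inner_eq_zero p.2 q.2 (Subtype.coe_injective.ne h)

namespace IsCopyableBasis

open Classical in
theorem inner_basis {ι : Type*} {F : DaggerFrobenius A} {b : Module.Basis ι ℂ A}
    (hb : F.IsCopyableBasis b) (i j : ι) :
    inner ℂ (b i) (b j) = if i = j then (‖b i‖ ^ 2 : ℂ) else 0 := by
  split_ifs with h
  · rw [h, inner_self_eq_norm_sq_to_K]
    rfl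
  · exact hb.inner_eq_zero h

theorem _root_.Module.Basis.norm_sq_ne_zero {ι : Type*} (b : Module.Basis ι ℂ A) (i : ι) :
    (‖b i‖ ^ 2 : ℂ) ≠ 0 :=
  pow_ne_zero _ (Complex.ofReal_ne_zero.2 (norm_ne_zero_iff.2 (b.ne_zero i)))

theorem comul_basis {ι : Type*} {F : DaggerFrobenius A} {b : Module.Basis ι ℂ A}
    (hb : F.IsCopyableBasis b) (i : ι) : F.comul (b i) = b i ⊗ₜ b i := (hb.mem i).2

theorem counit_basis {ι : Type*} {F : DaggerFrobenius A} {b : Module.Basis ι ℂ A}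
    (hb : F.IsCopyableBasis b) (i : ι) : F.counit (b i) = 1 := by
  rw [counit_apply, inner_unit_of_mem_copyablePoints (hb.mem i)]

variable {ι κ τ : Type*} [Fintype ι] [Fintype κ] [Fintype τ]

theorem inner_eq {F : DaggerFrobenius A} {b : Module.Basis ι ℂ A}
    (hb : F.IsCopyableBasis b) (i : ι) (v : A) :
    inner ℂ (b i) v = b.repr v i * (‖b i‖ ^ 2 : ℂ) := by
  classical
  conv_lhs => rw [← b.sum_repr v]
  simp only [inner_sum, inner_smul_right, hb.inner_basis, mul_ite, mul_zero, Finset.sum_ite_eq,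
    Finset.mem_univ, if_true]

theorem ext_inner {F : DaggerFrobenius A} {b : Module.Basis ι ℂ A}
    (hb : F.IsCopyableBasis b) {v w : A}
    (h : ∀ i, inner ℂ (b i) v = (inner ℂ (b i) w : ℂ)) : v = w := by
  refine b.ext_elem fun i => ?_
  have := h i
  rw [hb.inner_eq, hb.inner_eq] at this
  exact mul_right_cancel₀ (b.norm_sq_ne_zero i) this

open Classical in
-- Multiplication is adjoint to copying, so pairing with `b k` gives `⟨b k, b i⟩ ⟨b k, b j⟩`.
theorem mul_basis {F : DaggerFrobenius A} {b : Module.Basis ι ℂ A}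
    (hb : F.IsCopyableBasis b) (i j : ι) :
    F.mul (b i ⊗ₜ b j) = if i = j then (‖b i‖ ^ 2 : ℂ) • b i else 0 := by
  refine hb.ext_inner fun k => ?_
  have h := LinearMap.adjoint_inner_left F.mul (b i ⊗ₜ b j) (b k)
  rw [← h]
  change inner ℂ (F.comul (b k)) _ = _
  rw [hb.comul_basis, TensorProduct.inner_tmul, hb.inner_basis, hb.inner_basis]
  by_cases hij : i = j
  · subst hij
    simp only [if_true, inner_smul_right, hb.inner_basis]
    split_ifs with hk
    · rw [hk]
    · simp
  · rw [if_neg hij, inner_zero_right]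
    split_ifs with hk hk'
    · exact absurd (hk.symm.trans hk') hij
    all_goals simp

theorem unit_one {F : DaggerFrobenius A} {b : Module.Basis ι ℂ A}
    (hb : F.IsCopyableBasis b) : F.unit 1 = ∑ i, (‖b i‖ ^ 2 : ℂ)⁻¹ • b i := by
  classical
  refine hb.ext_inner fun k => ?_
  rw [← inner_conj_symm, inner_unit_of_mem_copyablePoints (hb.mem k)]
  simp only [map_one, inner_sum, inner_smul_right, hb.inner_basis, mul_ite, mul_zero,
    Finset.sum_ite_eq, Finset.mem_univ, if_true]
  exact (inv_mul_cancel₀ (b.norm_sq_ne_zero k)).symm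

theorem cup_one {F : DaggerFrobenius A} {b : Module.Basis ι ℂ A}
    (hb : F.IsCopyableBasis b) : F.cup 1 = ∑ i, (‖b i‖ ^ 2 : ℂ)⁻¹ • (b i ⊗ₜ[ℂ] b i) := by
  rw [cup, LinearMap.comp_apply, hb.unit_one, map_sum]
  simp only [map_smul, hb.comul_basis]

open Classical in
theorem cap_basis {F : DaggerFrobenius A} {b : Module.Basis ι ℂ A}
    (hb : F.IsCopyableBasis b) (i j : ι) :
    F.cap (b i ⊗ₜ b j) = if i = j then (‖b i‖ ^ 2 : ℂ) else 0 := by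
  rw [cap, LinearMap.comp_apply, hb.mul_basis]
  split_ifs
  · rw [map_smul, hb.counit_basis, smul_eq_mul, mul_one]
  · rw [map_zero]

/-- Copyable points are real for the self-duality: bending one with the cap equals taking its
adjoint. This is what converts `g†` into conjugate coordinates of `g`. -/
theorem cap_tmul_basis {F : DaggerFrobenius A} {b : Module.Basis ι ℂ A}
    (hb : F.IsCopyableBasis b) (v : A) (i : ι) :
    F.cap (v ⊗ₜ b i) = inner ℂ (b i) v := by
  classical
  rw [hb.inner_eq]
  conv_lhs => rw [← b.sum_repr v]
  rw [TensorProduct.sum_tmul, map_sum]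
  simp [← TensorProduct.smul_tmul', hb.cap_basis]

theorem inner_tensorProduct {FX : DaggerFrobenius X} {FB : DaggerFrobenius B}
    {bX : Module.Basis κ ℂ X} {bB : Module.Basis τ ℂ B}
    (hX : FX.IsCopyableBasis bX) (hB : FB.IsCopyableBasis bB) (x : κ) (j : τ)
    (t : X ⊗[ℂ] B) :
    inner ℂ (bX x ⊗ₜ[ℂ] bB j) t =
      (bX.tensorProduct bB).repr t (x, j) * ((‖bX x‖ ^ 2 : ℂ) * (‖bB j‖ ^ 2 : ℂ)) := by
  induction t with
  | zero => simp
  | tmul v w =>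
    rw [TensorProduct.inner_tmul, hX.inner_eq, hB.inner_eq,
      Module.Basis.tensorProduct_repr_tmul_apply, smul_eq_mul]
    ring
  | add v w hv hw => rw [inner_add_right, hv, hw, map_add, Finsupp.add_apply, add_mul]

theorem tensorCup_one {FX : DaggerFrobenius X} {FB : DaggerFrobenius B}
    {bX : Module.Basis κ ℂ X} {bB : Module.Basis τ ℂ B}
    (hX : FX.IsCopyableBasis bX) (hB : FB.IsCopyableBasis bB) :
    tensorCup FX FB 1 = ∑ x, ∑ j, ((‖bX x‖ ^ 2 : ℂ)⁻¹ * (‖bB j‖ ^ 2 : ℂ)⁻¹) •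
      ((bX x ⊗ₜ[ℂ] bB j) ⊗ₜ[ℂ] (bX x ⊗ₜ[ℂ] bB j)) := by
  simp only [tensorCup, LinearMap.comp_apply, LinearEquiv.coe_coe, TensorProduct.lid_symm_apply,
    TensorProduct.map_tmul, hX.cup_one, hB.cup_one, TensorProduct.sum_tmul, TensorProduct.tmul_sum,
    map_sum, TensorProduct.smul_tmul_smul, map_smul, TensorProduct.tensorTensorTensorComm_tmul]
  exact Finset.sum_comm

/-- In copyable bases, the matrix of `conj g` is the entrywise conjugate of the matrix of `g`. -/
theorem conj_basis {FA : DaggerFrobenius A} {FX : DaggerFrobenius X} {FB : DaggerFrobenius B}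
    {bA : Module.Basis ι ℂ A} {bX : Module.Basis κ ℂ X} {bB : Module.Basis τ ℂ B}
    (hA : FA.IsCopyableBasis bA) (hX : FX.IsCopyableBasis bX) (hB : FB.IsCopyableBasis bB)
    (g : A →ₗ[ℂ] X ⊗[ℂ] B) (i : ι) :
    conj FA FX FB g (bA i) = ∑ x, ∑ j,
      (starRingEnd ℂ) ((bX.tensorProduct bB).repr (g (bA i)) (x, j)) • (bX x ⊗ₜ[ℂ] bB j) := by
  simp only [conj, LinearMap.comp_apply, LinearEquiv.coe_coe, TensorProduct.lid_symm_apply,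
    LinearMap.rTensor_tmul, tensorCup_one hX hB, TensorProduct.sum_tmul, map_sum,
    ← TensorProduct.smul_tmul', map_smul, TensorProduct.assoc_tmul, LinearMap.lTensor_tmul,
    hA.cap_tmul_basis, LinearMap.adjoint_inner_right, TensorProduct.rid_tmul]
  refine Finset.sum_congr rfl fun x _ => Finset.sum_congr rfl fun j _ => ?_
  rw [← inner_conj_symm, inner_tensorProduct hX hB, smul_smul]
  congr 1
  have h1 := bX.norm_sq_ne_zero x
  have h2 := bB.norm_sq_ne_zero j
  simp only [map_mul, map_pow, Complex.conj_ofReal]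
  rw [mul_comm, _root_.mul_assoc, ← mul_inv, mul_inv_cancel₀ (mul_ne_zero h1 h2), mul_one]

theorem repr_conj_basis {FA : DaggerFrobenius A} {FX : DaggerFrobenius X}
    {FB : DaggerFrobenius B}
    {bA : Module.Basis ι ℂ A} {bX : Module.Basis κ ℂ X} {bB : Module.Basis τ ℂ B}
    (hA : FA.IsCopyableBasis bA) (hX : FX.IsCopyableBasis bX) (hB : FB.IsCopyableBasis bB)
    (g : A →ₗ[ℂ] X ⊗[ℂ] B) (i : ι) (x : κ) (j : τ) :
    (bX.tensorProduct bB).repr (conj FA FX FB g (bA i)) (x, j) =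
      (starRingEnd ℂ) ((bX.tensorProduct bB).repr (g (bA i)) (x, j)) := by
  have h := (bX.tensorProduct bB).repr_sum_self fun y =>
    (starRingEnd ℂ) ((bX.tensorProduct bB).repr (g (bA i)) y)
  rw [Fintype.sum_prod_type] at h
  simp only [Module.Basis.tensorProduct_apply] at h
  rw [conj_basis hA hX hB, h]

theorem cap_tmul {F : DaggerFrobenius A} {b : Module.Basis ι ℂ A}
    (hb : F.IsCopyableBasis b) (v w : A) :
    F.cap (v ⊗ₜ w) = ∑ i, b.repr v i * b.repr w i * (‖b i‖ ^ 2 : ℂ) := by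
  conv_lhs => rw [← b.sum_repr w]
  simp only [TensorProduct.tmul_sum, TensorProduct.tmul_smul, map_sum, map_smul,
    hb.cap_tmul_basis, hb.inner_eq, smul_eq_mul]
  exact Finset.sum_congr rfl fun i _ => by ring

theorem repr_join {τ : Type*} {FX : DaggerFrobenius X}
    {bX : Module.Basis κ ℂ X} {bB : Module.Basis τ ℂ B}
    (hX : FX.IsCopyableBasis bX) (s t : X ⊗[ℂ] B) (j j' : τ) :
    (bB.tensorProduct bB).repr (join FX B (s ⊗ₜ t)) (j, j') =
      ∑ x, (bX.tensorProduct bB).repr s (x, j) * (bX.tensorProduct bB).repr t (x, j') *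
        (‖bX x‖ ^ 2 : ℂ) := by
  induction s with
  | zero => simp
  | add s s' hs hs' =>
    simp only [TensorProduct.add_tmul, map_add, Finsupp.add_apply, hs, hs', add_mul,
      Finset.sum_add_distrib]
  | tmul v a =>
    induction t with
    | zero => simp
    | add t t' ht ht' =>
      simp only [TensorProduct.tmul_add, map_add, Finsupp.add_apply, ht, ht', mul_add, add_mul,
        Finset.sum_add_distrib]
    | tmul w c =>
      simp only [join, LinearMap.comp_apply, LinearEquiv.coe_coe,
        TensorProduct.tensorTensorTensorComm_tmul, LinearMap.rTensor_tmul, hX.cap_tmul,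
        TensorProduct.lid_tmul, map_smul, Finsupp.smul_apply, smul_eq_mul, Finset.sum_mul,
        Module.Basis.tensorProduct_repr_tmul_apply]
      exact Finset.sum_congr rfl fun x _ => by ring

/-- The right-hand side of the `stoch` condition. For `i = i'` and `j = j'` it is a weighted sum of
squared moduli. -/
theorem repr_join_conj {FA : DaggerFrobenius A} {FX : DaggerFrobenius X}
    {FB : DaggerFrobenius B}
    {bA : Module.Basis ι ℂ A} {bX : Module.Basis κ ℂ X} {bB : Module.Basis τ ℂ B}
    (hA : FA.IsCopyableBasis bA) (hX : FX.IsCopyableBasis bX) (hB : FB.IsCopyableBasis bB)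
    (g : A →ₗ[ℂ] X ⊗[ℂ] B) (i i' : ι) (j j' : τ) :
    (bB.tensorProduct bB).repr
      ((join FX B ∘ₗ TensorProduct.map (conj FA FX FB g) g) (bA i ⊗ₜ bA i')) (j, j') =
      ∑ x, (starRingEnd ℂ) ((bX.tensorProduct bB).repr (g (bA i)) (x, j)) *
        (bX.tensorProduct bB).repr (g (bA i')) (x, j') * (‖bX x‖ ^ 2 : ℂ) := by
  rw [LinearMap.comp_apply, TensorProduct.map_tmul, hX.repr_join]
  simp only [repr_conj_basis hA hX hB]

open Classical in
theorem repr_comul {F : DaggerFrobenius A} {b : Module.Basis ι ℂ A}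
    (hb : F.IsCopyableBasis b) (v : A) (j j' : ι) :
    (b.tensorProduct b).repr (F.comul v) (j, j') = if j = j' then b.repr v j else 0 := by
  conv_lhs => rw [← b.sum_repr v]
  simp only [map_sum, map_smul, hb.comul_basis, Finsupp.finsetSum_apply, Finsupp.smul_apply,
    Module.Basis.tensorProduct_repr_tmul_apply, Module.Basis.repr_self, Finsupp.single_apply,
    smul_eq_mul, mul_ite, mul_one, mul_zero]
  split_ifs with h
  · subst h
    simp
  · refine Finset.sum_eq_zero fun i _ => ?_
    split_ifs with h1 h2
    · exact absurd (h1.symm.trans h2) h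
    all_goals rfl

open Classical in
-- The left-hand side of the `stoch` condition: multiplying and copying kill all off-diagonal
-- entries.
theorem repr_comul_mul {FA : DaggerFrobenius A} {FB : DaggerFrobenius B}
    {bA : Module.Basis ι ℂ A} {bB : Module.Basis τ ℂ B}
    (hA : FA.IsCopyableBasis bA) (hB : FB.IsCopyableBasis bB)
    (f : A →ₗ[ℂ] B) (i i' : ι) (j j' : τ) :
    (bB.tensorProduct bB).repr ((FB.comul ∘ₗ f ∘ₗ FA.mul) (bA i ⊗ₜ bA i')) (j, j') =
      if i = i' ∧ j = j' then (‖bA i‖ ^ 2 : ℂ) * bB.repr (f (bA i)) j else 0 := by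
  rw [LinearMap.comp_apply, LinearMap.comp_apply, hB.repr_comul, hA.mul_basis, ite_and]
  by_cases hi : i = i'
  · simp [hi]
  · simp [hi]

end IsCopyableBasis

end DaggerFrobenius

/-! ### The algebra defined by an orthonormal basis. -/

namespace DaggerFrobenius

section Orthonormal

variable {A : FHilb.{u}} {κ : Type*} [Fintype κ] (e : OrthonormalBasis κ ℂ A)

/-- Multiplication of coordinates with respect to an orthonormal basis. -/
def coordMul : A ⊗[ℂ] A →ₗ[ℂ] A :=
  TensorProduct.lift (LinearMap.mk₂ ℂ
    (fun a b => e.repr.symm (WithLp.toLp 2 fun k => e.repr a k * e.repr b k))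
    (fun a a' b => e.repr.injective (by ext k; simp [add_mul]))
    (fun c a b => e.repr.injective (by ext k; simp [_root_.mul_assoc]))
    (fun a b b' => e.repr.injective (by ext k; simp [mul_add]))
    (fun c a b => e.repr.injective (by ext k; simp [mul_left_comm])))

theorem repr_coordMul_tmul (a b : A) (k : κ) :
    e.repr (coordMul e (a ⊗ₜ b)) k = e.repr a k * e.repr b k := by
  simp [coordMul]

/-- The vector all of whose coordinates are one. -/
def coordUnit : ℂ →ₗ[ℂ] A :=
  LinearMap.toSpanSingleton ℂ A (e.repr.symm (WithLp.toLp 2 fun _ => 1))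

theorem repr_coordUnit (c : ℂ) (k : κ) : e.repr (coordUnit e c) k = c := by
  simp [coordUnit]

theorem adjoint_coordMul (a : A) :
    LinearMap.adjoint (coordMul e) a = ∑ k, e.repr a k • (e k ⊗ₜ[ℂ] e k) := by
  refine TensorProduct.ext_iff_inner_left.2 fun b c => ?_
  rw [LinearMap.adjoint_inner_right, ← e.repr.inner_map_map, PiLp.inner_apply, inner_sum]
  refine Finset.sum_congr rfl fun k _ => ?_
  rw [repr_coordMul_tmul, inner_smul_right, TensorProduct.inner_tmul, e.repr_apply_apply b,
    e.repr_apply_apply c, RCLike.inner_apply, map_mul, inner_conj_symm, inner_conj_symm]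

theorem coordMul_basis_left (a : A) (k : κ) :
    coordMul e (e k ⊗ₜ a) = e.repr a k • e k := by
  classical
  refine e.repr.injective (PiLp.ext fun l => ?_)
  rw [repr_coordMul_tmul, e.repr_self, map_smul, e.repr_self, PiLp.smul_apply, PiLp.single_apply]
  split_ifs with h
  · simp [h]
  · simp

theorem coordMul_basis_right (a : A) (k : κ) :
    coordMul e (a ⊗ₜ e k) = e.repr a k • e k := by
  rw [← coordMul_basis_left]
  refine e.repr.injective (PiLp.ext fun l => ?_)
  rw [repr_coordMul_tmul, repr_coordMul_tmul, mul_comm]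

/-- The dagger Frobenius algebra whose copyable points are a given orthonormal basis. -/
def ofOrthonormalBasis : DaggerFrobenius A where
  mul := coordMul e
  unit := coordUnit e
  mul_assoc := TensorProduct.ext_threefold fun a b c => e.repr.injective <| PiLp.ext fun k => by
    simp [repr_coordMul_tmul, _root_.mul_assoc]
  unit_mul := TensorProduct.ext' fun c a => e.repr.injective <| PiLp.ext fun k => by
    simp [repr_coordMul_tmul, repr_coordUnit]
  mul_unit := TensorProduct.ext' fun a c => e.repr.injective <| PiLp.ext fun k => by
    simp [repr_coordMul_tmul, repr_coordUnit, mul_comm]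
  frobenius_left := TensorProduct.ext' fun a b => by
    simp [adjoint_coordMul, TensorProduct.tmul_sum, coordMul_basis_right, repr_coordMul_tmul,
      TensorProduct.smul_tmul', mul_comm]
  frobenius_right := TensorProduct.ext' fun a b => by
    simp [adjoint_coordMul, TensorProduct.sum_tmul, coordMul_basis_left, repr_coordMul_tmul,
      ← TensorProduct.smul_tmul', smul_smul]

theorem ofOrthonormalBasis_isCommutative : (ofOrthonormalBasis e).IsCommutative :=
  TensorProduct.ext' fun a b => e.repr.injective <| PiLp.ext fun k => by
    simp [ofOrthonormalBasis, repr_coordMul_tmul, mul_comm]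

theorem ofOrthonormalBasis_isCopyableBasis :
    (ofOrthonormalBasis e).IsCopyableBasis e.toBasis where
  mem i := by
    classical
    refine ⟨Module.Basis.ne_zero _ i, ?_⟩
    change LinearMap.adjoint (coordMul e) _ = _
    rw [adjoint_coordMul, e.coe_toBasis, e.repr_self]
    simp [PiLp.single_apply]
  inner_eq_zero {i j} h := by
    rw [e.coe_toBasis, e.inner_eq_zero h]

theorem ofOrthonormalBasis_isNormalisable : (ofOrthonormalBasis e).IsNormalisable := by
  -- The identity normalises, because `L_(e i)` is the projection onto `e i`, of trace 1, the value
  -- of the counit.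
  refine ⟨LinearMap.id, ⟨by simp, by simp⟩, ⟨Function.bijective_id, A, LinearMap.id, by simp⟩,
    e.toBasis.ext fun i => ?_⟩
  classical
  rw [(ofOrthonormalBasis_isCopyableBasis e).counit_basis]
  simp only [loop, LinearMap.comp_apply, LinearMap.trace_eq_sum_inner _ e, ofOrthonormalBasis,
    TensorProduct.curry_apply, coordMul_basis_right, inner_smul_right, LinearMap.id_apply,
    e.inner_eq_one, mul_one, e.coe_toBasis, e.repr_self, PiLp.single_apply]
  simp

end Orthonormal

end DaggerFrobenius

/-! ### Morphisms of `Stoch[FHilb]` as nonnegative matrices. -/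

namespace StochObj

/-- The Hilbert space `ℂ^κ` with entrywise multiplication. -/
def euclidean (κ : Type u) [Fintype κ] : StochObj.{u} where
  space := ⟨EuclideanSpace ℂ κ⟩
  alg := DaggerFrobenius.ofOrthonormalBasis (A := ⟨EuclideanSpace ℂ κ⟩)
    (EuclideanSpace.basisFun κ ℂ)
  isCommutative := DaggerFrobenius.ofOrthonormalBasis_isCommutative _
  isNormalisable := DaggerFrobenius.ofOrthonormalBasis_isNormalisable _

/-- The standard basis of `ℂ^κ`. -/
def euclideanBasis (κ : Type u) [Fintype κ] :
    OrthonormalBasis κ ℂ (euclidean κ).space :=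
  EuclideanSpace.basisFun κ ℂ

theorem euclideanBasis_isCopyableBasis (κ : Type u) [Fintype κ] :
    (euclidean κ).alg.IsCopyableBasis (euclideanBasis κ).toBasis :=
  DaggerFrobenius.ofOrthonormalBasis_isCopyableBasis _

/-- The basis of copyable points. -/
def basis (A : StochObj.{u}) : Module.Basis A.alg.copyablePoints ℂ A.space :=
  A.isCommutative.copyableBasis

theorem basis_apply (A : StochObj.{u}) (p : A.alg.copyablePoints) : A.basis p = p :=
  A.isCommutative.copyableBasis_apply p

theorem basis_isCopyableBasis (A : StochObj.{u}) : A.alg.IsCopyableBasis A.basis :=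
  A.isCommutative.isCopyableBasis

instance (A : StochObj.{u}) : Fintype A.alg.copyablePoints :=
  FiniteDimensional.fintypeBasisIndex A.basis

open ComplexOrder in
/-- The morphisms of `Stoch[FHilb]` are the maps whose matrices with respect to copyable points
have nonnegative entries. -/
theorem stoch_iff {A B : StochObj.{u}} (f : A ⟶ B) :
    stoch f ↔ ∀ i j, 0 ≤ B.basis.repr (f.lin (A.basis i)) j := by
  classical
  have hA := A.basis_isCopyableBasis
  have hB := B.basis_isCopyableBasis
  constructor
  · rintro ⟨X, g, h⟩ i j
    have hX := X.basis_isCopyableBasis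
    -- Only the entries with `i = i'` and `j = j'` are needed here.
    have h1 := congrArg (fun t => (B.basis.tensorProduct B.basis).repr t (j, j))
      (LinearMap.congr_fun h (A.basis i ⊗ₜ A.basis i))
    rw [hA.repr_comul_mul hB, hA.repr_join_conj hX hB, if_pos ⟨rfl, rfl⟩] at h1
    have hpos : ∀ {C : StochObj.{u}} (k : C.alg.copyablePoints), (0 : ℂ) < ‖C.basis k‖ ^ 2 :=
      fun {C} k => by
        have := norm_pos_iff.2 (C.basis.ne_zero k)
        exact_mod_cast pow_pos this 2
    refine le_of_mul_le_mul_left ?_ (hpos i)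
    rw [h1, mul_zero]
    refine Finset.sum_nonneg fun x _ => mul_nonneg ?_ (hpos x).le
    exact star_mul_self_nonneg _
  · intro h
    -- The ancilla records the pair `(i, j)`, so the sum over `x` vanishes off the diagonal.
    let X := euclidean (A.alg.copyablePoints × B.alg.copyablePoints)
    let e := (euclideanBasis (A.alg.copyablePoints × B.alg.copyablePoints)).toBasis
    have hX : X.alg.IsCopyableBasis e := euclideanBasis_isCopyableBasis _
    -- The factor `‖A.basis i‖` compensates for `‖b_i‖²` in `mul_basis`.
    let c : A.alg.copyablePoints → B.alg.copyablePoints → ℝ := fun i j =>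
      ‖A.basis i‖ * √(B.basis.repr (f.lin (A.basis i)) j).re
    let g : A.space →ₗ[ℂ] X.space ⊗[ℂ] B.space := A.basis.constr ℂ fun i =>
      (e.tensorProduct B.basis).equivFun.symm fun y =>
        if y.1 = (i, y.2) then (c i y.2 : ℂ) else 0
    have hg : ∀ i x j, (e.tensorProduct B.basis).repr (g (A.basis i)) (x, j) =
        if x = (i, j) then (c i j : ℂ) else 0 := fun i x j => by
      rw [Module.Basis.constr_basis, ← Module.Basis.equivFun_apply, LinearEquiv.apply_symm_apply]
    have hc : ∀ i j, (c i j : ℂ) * c i j =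
        (‖A.basis i‖ ^ 2 : ℂ) * B.basis.repr (f.lin (A.basis i)) j := fun i j => by
      obtain ⟨hre, him⟩ := Complex.nonneg_iff.1 (h i j)
      rw [← Complex.ofReal_mul, mul_mul_mul_comm, Real.mul_self_sqrt hre, Complex.ofReal_mul,
        ← sq, Complex.ofReal_pow]
      congr 1
      exact Complex.ext rfl him
    refine ⟨X, g, (A.basis.tensorProduct A.basis).ext fun ii =>
      (B.basis.tensorProduct B.basis).ext_elem fun jj => ?_⟩
    rw [Module.Basis.tensorProduct_apply, hA.repr_comul_mul hB, hA.repr_join_conj hX hB]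
    have he : ∀ x, ‖e x‖ = 1 := fun x => by
      rw [OrthonormalBasis.coe_toBasis, OrthonormalBasis.norm_eq_one]
    simp only [hg, he, Complex.ofReal_one, one_pow, mul_one, mul_ite, mul_zero,
      Finset.sum_ite_eq', Finset.mem_univ, if_true]
    by_cases hij : ii.1 = ii.2 ∧ jj.1 = jj.2
    · rw [if_pos hij, if_pos (by rw [hij.1, hij.2]), hij.1, hij.2, Complex.conj_ofReal, hc]
    · rw [if_neg hij, if_neg (fun h' => hij ⟨(congrArg Prod.fst h').symm,
        (congrArg Prod.snd h').symm⟩), map_zero, zero_mul]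

end StochObj

/-! ### The matrix functor. -/

namespace StochObj

theorem lin_basis {A B : StochObj.{u}} (f : A ⟶ B) (i : A.alg.copyablePoints) :
    f.lin (A.basis i) = ∑ j, B.basis.repr (f.lin (A.basis i)) j • B.basis j :=
  (B.basis.sum_repr _).symm

theorem repr_comp {A B C : StochObj.{u}} (f : A ⟶ B) (g : B ⟶ C) (i : A.alg.copyablePoints)
    (k : C.alg.copyablePoints) :
    C.basis.repr ((f ≫ g).lin (A.basis i)) k =
      ∑ j, C.basis.repr (g.lin (B.basis j)) k * B.basis.repr (f.lin (A.basis i)) j := by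
  change C.basis.repr (g.lin (f.lin (A.basis i))) k = _
  conv_lhs => rw [lin_basis f i]
  simp only [map_sum, map_smul, Finsupp.finsetSum_apply, Finsupp.smul_apply, smul_eq_mul, mul_comm]

open Classical in
theorem repr_id (A : StochObj.{u}) (i k : A.alg.copyablePoints) :
    A.basis.repr ((𝟙 A : A ⟶ A).lin (A.basis i)) k = if k = i then 1 else 0 := by
  change A.basis.repr (A.basis i) k = _
  rw [A.basis.repr_self, Finsupp.single_apply]
  simp only [eq_comm]

open ComplexOrder in
-- By `stoch_iff` this is closure of nonnegative matrices under products, so no ancilla for a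
-- composite has to be built.
theorem stoch_isMultiplicative : stoch.{u}.IsMultiplicative where
  id_mem A := (stoch_iff _).2 fun i j => by
    classical
    rw [repr_id]
    split_ifs
    · exact zero_le_one
    · exact le_rfl
  comp_mem f g hf hg := (stoch_iff _).2 fun i j => by
    rw [repr_comp]
    exact Finset.sum_nonneg fun k _ =>
      mul_nonneg ((stoch_iff g).1 hg k j) ((stoch_iff f).1 hf i k)

instance : stoch.{u}.IsMultiplicative := stoch_isMultiplicative

/-- The counit takes the value 1 on copyable points, so it sums coordinates. -/
theorem normalised_iff {A B : StochObj.{u}} (f : A ⟶ B) :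
    normalised f ↔ ∀ i, ∑ j, B.basis.repr (f.lin (A.basis i)) j = 1 := by
  have h : ∀ v, B.alg.counit v = ∑ j, B.basis.repr v j := fun v => by
    conv_lhs => rw [← B.basis.sum_repr v]
    simp only [map_sum, map_smul, B.basis_isCopyableBasis.counit_basis, smul_eq_mul, mul_one]
  refine ⟨fun hf i => ?_, fun hf => A.basis.ext fun i => ?_⟩
  · rw [← h, ← A.basis_isCopyableBasis.counit_basis i]
    exact LinearMap.congr_fun hf _
  · rw [LinearMap.comp_apply, h, hf, A.basis_isCopyableBasis.counit_basis]

/-- The real parts of the matrix entries with respect to copyable points. -/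
def toMatrix {A B : StochObj.{u}} (f : A ⟶ B) :
    Matrix B.alg.copyablePoints A.alg.copyablePoints ℝ :=
  fun j i => (B.basis.repr (f.lin (A.basis i)) j).re

open ComplexOrder in
theorem ofReal_toMatrix {A B : StochObj.{u}} {f : A ⟶ B} (hf : stoch f)
    (i : A.alg.copyablePoints) (j : B.alg.copyablePoints) :
    (toMatrix f j i : ℂ) = B.basis.repr (f.lin (A.basis i)) j :=
  Complex.ext rfl (Complex.nonneg_iff.1 ((stoch_iff f).1 hf i j)).2

/-- The normalised morphisms of `Stoch[FHilb]`. -/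
abbrev Normalised : Type (u + 1) := WideSubcategory (stoch.{u} ⊓ normalised.{u})

open ComplexOrder in
/-- The functor that takes matrices with respect to copyable points. -/
def matrixFunctor : Normalised.{u} ⥤ FinStoch.{u} where
  obj A := ⟨A.obj.alg.copyablePoints⟩
  map {A B} f :=
    { matrix := toMatrix f.hom
      nonneg := fun j i => (Complex.nonneg_iff.1 ((stoch_iff f.hom).1 f.property.1 i j)).1
      sum_col := fun i => by
        have h := congrArg Complex.re ((normalised_iff f.hom).1 f.property.2 i)
        rwa [Complex.re_sum] at h }
  map_id A := FinStoch.Hom.ext <| Matrix.ext fun j i => by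
    -- The identity of `FinStoch` uses classical decidability, so that instance is given explicitly.
    refine Eq.trans ?_
      (@Matrix.one_apply _ ℝ (fun p q => Classical.propDecidable (p = q)) _ _ j i).symm
    change (A.obj.basis.repr ((𝟙 A.obj : A.obj ⟶ A.obj).lin (A.obj.basis i)) j).re = _
    rw [repr_id]
    split_ifs <;> rfl
  map_comp {A B C} f g := FinStoch.Hom.ext <| Matrix.ext fun k i => by
    change toMatrix (f.hom ≫ g.hom) k i = ∑ j, toMatrix g.hom k j * toMatrix f.hom j i
    -- Real parts are not multiplicative; the comparison is made in `ℂ`, where the entries are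
    -- already real.
    apply Complex.ofReal_injective
    rw [ofReal_toMatrix (stoch.comp_mem _ _ f.property.1 g.property.1), repr_comp,
      Complex.ofReal_sum]
    refine Finset.sum_congr rfl fun j _ => ?_
    rw [Complex.ofReal_mul, ofReal_toMatrix f.property.1, ofReal_toMatrix g.property.1]

theorem hom_lin_basis {A B : Normalised.{u}} (f : A ⟶ B) (i : (matrixFunctor.obj A).ι) :
    f.hom.lin (A.obj.basis i) =
      ∑ j, (((matrixFunctor.map f).matrix j i : ℝ) : ℂ) • B.obj.basis j :=
  (lin_basis f.hom i).trans <| Finset.sum_congr rfl fun j _ =>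
    congrArg (fun c : ℂ => c • B.obj.basis j) (ofReal_toMatrix f.property.1 i j).symm

instance : matrixFunctor.{u}.Faithful where
  map_injective {A B f g} h := by
    apply WideSubcategory.hom_ext
    refine Hom.ext (A.obj.basis.ext fun i => ?_)
    rw [hom_lin_basis f i, hom_lin_basis g i, h]

open ComplexOrder in
instance : matrixFunctor.{u}.Full where
  map_surjective {A B} M := by
    let f : A.obj ⟶ B.obj := ⟨A.obj.basis.constr ℂ fun i =>
      B.obj.basis.equivFun.symm fun j => ((M.matrix j i : ℝ) : ℂ)⟩
    have hf : ∀ i j, B.obj.basis.repr (f.lin (A.obj.basis i)) j = ((M.matrix j i : ℝ) : ℂ) :=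
      fun i j => by
        rw [Module.Basis.constr_basis, ← Module.Basis.equivFun_apply,
          LinearEquiv.apply_symm_apply]
    have h1 : stoch f := (stoch_iff f).2 fun i j => by
      rw [hf]
      exact Complex.zero_le_real.2 (M.nonneg j i)
    have h2 : normalised f := (normalised_iff f).2 fun i => by
      simp only [hf]
      rw [← Complex.ofReal_sum]
      exact congrArg Complex.ofReal (M.sum_col i)
    refine ⟨⟨f, h1, h2⟩, FinStoch.Hom.ext <| Matrix.ext fun j i => ?_⟩
    exact (congrArg Complex.re (hf i j)).trans (Complex.ofReal_re _)

end StochObj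

/-! ### Permutation matrices and essential surjectivity. -/

namespace FinStoch

open Classical in
/-- A bijection between index sets, as a permutation matrix. -/
def ofEquiv {I J : FinStoch.{u}} (e : I.ι ≃ J.ι) : I ⟶ J where
  matrix j i := if e i = j then 1 else 0
  nonneg j i := by split_ifs <;> simp
  sum_col i := by simp

theorem ofEquiv_comp_ofEquiv_symm {I J : FinStoch.{u}} (e : I.ι ≃ J.ι) :
    ofEquiv e ≫ ofEquiv e.symm = 𝟙 I := Hom.ext <| Matrix.ext fun k i => by
  classical
  change ∑ j, (if e.symm j = k then (1 : ℝ) else 0) * (if e i = j then 1 else 0) =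
    (1 : Matrix _ _ ℝ) k i
  simp [Matrix.one_apply, eq_comm]

/-- A bijection between index sets induces an isomorphism of stochastic maps. -/
def isoOfEquiv {I J : FinStoch.{u}} (e : I.ι ≃ J.ι) : I ≅ J where
  hom := ofEquiv e
  inv := ofEquiv e.symm
  hom_inv_id := ofEquiv_comp_ofEquiv_symm e
  inv_hom_id := ofEquiv_comp_ofEquiv_symm e.symm

end FinStoch

namespace StochObj

/-- Both the copyable points and `I.ι` index bases of `ℂ^I`, and any bijection between them yields
an isomorphism. -/
instance : matrixFunctor.{u}.EssSurj where
  mem_essImage I :=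
    ⟨⟨euclidean I.ι⟩, ⟨FinStoch.isoOfEquiv
      ((euclidean I.ι).basis.indexEquiv (euclideanBasis I.ι).toBasis)⟩⟩

instance : matrixFunctor.{u}.IsEquivalence where

end StochObj

end

theorem mainTheorem10 :
    ∃ _ : StochObj.stoch.{u}.IsMultiplicative,
    ∃ (E : WideSubcategory (StochObj.stoch.{u} ⊓ StochObj.normalised.{u}) ≌ FinStoch.{u})
      (b : ∀ A : WideSubcategory (StochObj.stoch.{u} ⊓ StochObj.normalised.{u}),
        Module.Basis (E.functor.obj A).ι ℂ A.obj.space),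
      (∀ A, Set.range (b A) = A.obj.alg.copyablePoints) ∧
      (∀ A i j, i ≠ j → inner ℂ (b A i) (b A j) = 0) ∧
      ∀ (A B : WideSubcategory (StochObj.stoch.{u} ⊓ StochObj.normalised.{u})) (f : A ⟶ B)
        (i : (E.functor.obj A).ι),
        f.hom.lin (b A i) = ∑ j, (((E.functor.map f).matrix j i : ℝ) : ℂ) • b B j := by
  refine ⟨StochObj.stoch_isMultiplicative, StochObj.matrixFunctor.asEquivalence,
    fun A => A.obj.basis,
    fun A => (congrArg Set.range (funext A.obj.basis_apply)).trans Subtype.range_coe,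
    fun A i j h => A.obj.basis_isCopyableBasis.inner_eq_zero h,
    fun A B f i => StochObj.hom_lin_basis f i⟩
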